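/- Let $0 < p \le 2$ and let $r, s > 0$. Put $c_p := 2\,\Gamma(1+1/p)$, $f(x) = f^{(p)}(x) := \exp\bigl(-(c_p|x|)^p\bigr)$ for $x \in \mathbb{R}$, $f_t(x) := f(x/t)$ for $t > 0$, and $\|(r,s)\|_p := (r^p+s^p)^{1/p}$. Let $D_r$ be either the continuous distribution on $\mathbb{R}$ with probability density function $f_r(x)/r$, or the discrete distribution on $\mathbb{Z}$ with probability mass function $f_r(x)/\sum_{z\in\mathbb{Z}} f_r(z)$. Then both are well-defined probability distributions, $f_s$ is integrable with respect to $D_r$, and \[ \mathbb{E}_{e \leftarrow D_r}[f_s(e)] \;\ge\; \frac{s}{\|(r,s)\|_p}, \] with equality in the continuous case and strict inequality in the discrete case. -/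

import Mathlib

open MeasureTheory

noncomputable section

namespace SoftDecoding

/-- The normalizing constant `c_p = 2 Γ(1 + 1/p)`. -/
def cp (p : ℝ) : ℝ := 2 * Real.Gamma (1 + 1 / p)

/-- The function `f^{(p)}(x) = exp (-(c_p |x|)^p)`. -/
def fp (p : ℝ) (x : ℝ) : ℝ := Real.exp (-(cp p * |x|) ^ p)

/-- The scaling `f_s(x) = f(x / s)`. -/
def scaled (f : ℝ → ℝ) (s : ℝ) (x : ℝ) : ℝ := f (x / s)

/-- The `ℓ_p` (quasi)norm `(∑ i, |x i|^p)^(1/p)` on `ℝⁿ`, for real `p > 0`. -/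
def lpNorm (p : ℝ) {n : ℕ} (x : Fin n → ℝ) : ℝ := (∑ i, |x i| ^ p) ^ (1 / p)

/-- The continuous distribution on `ℝ` with density `f_r(x) / r`, where `f = f^{(p)}`. -/
def contDist (p r : ℝ) : Measure ℝ :=
  volume.withDensity fun x => ENNReal.ofReal (scaled (fp p) r x / r)

/-- The discrete distribution on `ℤ` with mass function `f_r(x) / f_r(ℤ)`, where
`f = f^{(p)}` and `f_r(ℤ) = ∑_{z ∈ ℤ} f_r(z)`. -/
def discDist (p r : ℝ) : Measure ℤ :=
  Measure.count.withDensity fun x =>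
    ENNReal.ofReal (scaled (fp p) r x / ∑' z : ℤ, scaled (fp p) r z)

/-- `E_{e ← D_r}[f_s(e)]` for the continuous distribution `D_r`. -/
def muCont (p r s : ℝ) : ℝ := ∫ e, scaled (fp p) s e ∂(contDist p r)

/-- `E_{e ← D_r}[f_s(e)]` for the discrete distribution `D_r`. -/
def muDisc (p r s : ℝ) : ℝ := ∫ e : ℤ, scaled (fp p) s (e : ℝ) ∂(discDist p r)

end SoftDecoding

end

open Filter Topology

namespace SoftDecoding

/-! Since `f_r f_s = f_t` with `t = rs/‖(r,s)‖_p < r`, the continuous mean is `t/r`, and the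
discrete claim says that `c ∑ F(c² z²)` strictly increases in `c` for `F(u) = exp(-u^α)`, `α = p/2 ≤
1`. For `F(u) = exp(-l u)` this follows from Poisson summation (`mul_tsum_exp_neg_mul_sq`): each
nonzero dual term increases. The general `F` is reached from these exponentials by nonnegative
combinations and dominated limits (`LatticeIneq.exp_neg_rpow`), without a Bernstein representation.
Limits lose strictness, so `LatticeIneq` carries the margin `ε (F 1 - 2 F Y)`, linear in `F`, with
`ε` independent of `l`. -/

/-! ### Gaussian lattice sums -/

/-- As `l → 0` the right side decays like `exp(-A/l)`, up to powers of `l`; the term `2 exp(-lY)`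
makes the left side nonpositive there. For large `l` the right side decays only polynomially. -/
theorem exists_pos_mul_exp_sub_le {A B Y : ℝ} (hA : 0 < A) (hAB : A < B) (hY : 1 < Y) :
    ∃ ε > 0, ∀ l > 0, ε * (Real.exp (-(l * 1)) - 2 * Real.exp (-(l * Y))) ≤
      √(Real.pi / l) * (Real.exp (-(A / l)) - Real.exp (-(B / l))) := by
  have hlog : 0 < Real.log 2 := Real.log_pos one_lt_two
  -- The zero of `exp(-l) - 2 exp(-lY)`.
  obtain ⟨l₀, hl₀⟩ : ∃ l₀, l₀ = Real.log 2 / (Y - 1) := ⟨_, rfl⟩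
  have hl₀pos : 0 < l₀ := hl₀ ▸ div_pos hlog (by linarith)
  obtain ⟨D, hD⟩ : ∃ D, D = B - A := ⟨_, rfl⟩
  have hDpos : 0 < D := by linarith
  refine ⟨Real.exp (-(A / l₀)) * (D / (4 * (1 + D))), by positivity, fun l hl => ?_⟩
  have hmono : Real.exp (-(B / l)) ≤ Real.exp (-(A / l)) := by
    rw [Real.exp_le_exp, neg_le_neg_iff]; gcongr
  rcases le_total l l₀ with hle | hle
  · refine le_trans (mul_nonpos_of_nonneg_of_nonpos (by positivity) ?_)
      (mul_nonneg (Real.sqrt_nonneg _) (sub_nonneg.2 hmono))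
    have : l * (Y - 1) ≤ Real.log 2 := by
      rw [hl₀, le_div_iff₀ (by linarith)] at hle; exact hle
    have h2 : Real.exp (-(l * 1)) ≤ Real.exp (Real.log 2 + -(l * Y)) :=
      Real.exp_le_exp.2 (by linarith)
    rw [Real.exp_add, Real.exp_log two_pos] at h2
    linarith
  · have h1 : Real.exp (-(A / l₀)) ≤ Real.exp (-(A / l)) := by
      rw [Real.exp_le_exp, neg_le_neg_iff]; gcongr
    have h2 : D / (l + D) ≤ 1 - Real.exp (-(D / l)) := by
      have h := Real.add_one_le_exp (D / l)
      have h3 : Real.exp (-(D / l)) ≤ l / (l + D) := by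
        rw [Real.exp_neg, inv_le_comm₀ (Real.exp_pos _) (by positivity), inv_div]
        refine le_trans (le_of_eq ?_) h
        field_simp
        ring
      have : D / (l + D) = 1 - l / (l + D) := by field_simp; ring
      linarith
    have h3 : 1 / (1 + l) ≤ √(Real.pi / l) := by
      apply Real.le_sqrt_of_sq_le
      rw [div_pow, div_le_div_iff₀ (by positivity) hl]
      nlinarith [Real.pi_gt_three]
    have h4 : (1 + l) * (l + D) ≤ 4 * (1 + D) * Real.exp l := by
      have h := Real.add_one_le_exp (l / 2)
      have h' : (1 + l / 2) ^ 2 ≤ Real.exp l := by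
        have : Real.exp l = Real.exp (l / 2) ^ 2 := by
          rw [← Real.exp_nat_mul]; congr 1; push_cast; ring
        rw [this]; gcongr; linarith
      have : (1 + l) * (l + D) ≤ 4 * (1 + D) * (1 + l / 2) ^ 2 := by
        nlinarith [mul_pos hl hDpos, mul_pos (mul_pos hl hl) hDpos]
      exact this.trans (by gcongr)
    have h5 : Real.exp (-(B / l)) = Real.exp (-(A / l)) * Real.exp (-(D / l)) := by
      rw [← Real.exp_add]; congr 1; rw [hD]; ring
    calc _ ≤ Real.exp (-(A / l₀)) * (D / (4 * (1 + D))) * Real.exp (-(l * 1)) := by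
          gcongr; linarith [Real.exp_pos (-(l * Y))]
      _ = Real.exp (-(A / l₀)) * (D / (4 * (1 + D) * Real.exp l)) := by
          rw [mul_one, Real.exp_neg l]; field_simp
      _ ≤ Real.exp (-(A / l)) * (D / ((1 + l) * (l + D))) := by gcongr
      _ = (1 / (1 + l)) * (Real.exp (-(A / l)) * (D / (l + D))) := by field_simp
      _ ≤ √(Real.pi / l) * (Real.exp (-(A / l)) * (1 - Real.exp (-(D / l)))) := by
          gcongr
      _ = _ := by rw [h5]; ring

theorem summable_exp_neg_rpow_sq {c α : ℝ} (hc : 0 < c) (hα : 0 < α) :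
    Summable fun z : ℤ => Real.exp (-(c ^ 2 * (z : ℝ) ^ 2) ^ α) := by
  -- With `αN ≥ 1`, the bound `x^N / N! ≤ exp x` gives comparison with `1/z²`.
  obtain ⟨N, hN⟩ := exists_nat_ge (1 / α)
  have hN' : 1 ≤ α * N := by rw [div_le_iff₀ hα] at hN; linarith
  have hs : Summable fun z : ℤ => (N.factorial / (c ^ 2) ^ (α * N)) * (1 / (z : ℝ) ^ 2) :=
    (Real.summable_one_div_int_pow.2 one_lt_two).mul_left _
  refine hs.of_norm_bounded_eventually ?_
  have hfin : ({0} : Set ℤ).Finite := Set.finite_singleton 0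
  filter_upwards [hfin.compl_mem_cofinite] with z hz
  have hz0 : z ≠ 0 := by simpa using hz
  have hz1 : (1 : ℝ) ≤ (z : ℝ) ^ 2 := by
    have : (1 : ℤ) ≤ z ^ 2 := by have := sq_pos_of_ne_zero hz0 ; omega
    exact_mod_cast this
  have hx : 0 < (c ^ 2 * (z : ℝ) ^ 2) ^ α := by positivity
  have h := Real.pow_div_factorial_le_exp _ hx.le N
  rw [Real.norm_of_nonneg (Real.exp_pos _).le, Real.exp_neg, div_mul_div_comm, mul_one]
  rw [inv_le_comm₀ (Real.exp_pos _) (by positivity), inv_div]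
  refine le_trans ?_ h
  have hpow : ((c ^ 2 * (z : ℝ) ^ 2) ^ α) ^ N =
      (c ^ 2) ^ (α * N) * ((z : ℝ) ^ 2) ^ (α * N) := by
    rw [← Real.mul_rpow (by positivity) (by positivity), Real.rpow_mul (by positivity),
      Real.rpow_natCast]
  rw [hpow]
  gcongr
  exact Real.self_le_rpow_of_one_le hz1 hN'

theorem summable_exp_neg_mul_sq {l c : ℝ} (hl : 0 < l) (hc : 0 < c) :
    Summable fun z : ℤ => Real.exp (-(l * (c ^ 2 * (z : ℝ) ^ 2))) := by
  have h := summable_exp_neg_rpow_sq (c := √l * c) (α := 1) (by positivity) one_pos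
  refine h.congr fun z => ?_
  rw [Real.rpow_one, mul_pow, Real.sq_sqrt hl.le, mul_assoc]

theorem mul_tsum_exp_neg_mul_sq {l c : ℝ} (hl : 0 < l) (hc : 0 < c) :
    c * ∑' z : ℤ, Real.exp (-(l * (c ^ 2 * (z : ℝ) ^ 2))) =
      √(Real.pi / l) * ∑' z : ℤ, Real.exp (-(Real.pi ^ 2 / c ^ 2 * (z : ℝ) ^ 2 / l)) := by
  have hπ := Real.pi_pos
  have h := Real.tsum_exp_neg_mul_int_sq (a := l * c ^ 2 / Real.pi) (by positivity)
  have e1 : ∀ z : ℤ, -Real.pi * (l * c ^ 2 / Real.pi) * (z : ℝ) ^ 2 =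
      -(l * (c ^ 2 * (z : ℝ) ^ 2)) := fun z => by field_simp
  have e2 : ∀ z : ℤ, -Real.pi / (l * c ^ 2 / Real.pi) * (z : ℝ) ^ 2 =
      -(Real.pi ^ 2 / c ^ 2 * (z : ℝ) ^ 2 / l) := fun z => by field_simp
  simp only [e1, e2] at h
  rw [h, ← mul_assoc, ← Real.sqrt_eq_rpow]
  congr 1
  have : l * c ^ 2 / Real.pi = (Real.pi / l)⁻¹ * c ^ 2 := by field_simp
  rw [this, Real.sqrt_mul (by positivity), Real.sqrt_sq hc.le, Real.sqrt_inv]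
  field_simp

/-- A quantitative form of `a ∑ F (a² z²) < b ∑ F (b² z²)`, linear in `F`. -/
structure LatticeIneq (a b ε Y : ℝ) (F : ℝ → ℝ) : Prop where
  summable_left : Summable fun z : ℤ => F (a ^ 2 * (z : ℝ) ^ 2)
  summable_right : Summable fun z : ℤ => F (b ^ 2 * (z : ℝ) ^ 2)
  le : ε * (F 1 - 2 * F Y) + a * ∑' z : ℤ, F (a ^ 2 * (z : ℝ) ^ 2) ≤
    b * ∑' z : ℤ, F (b ^ 2 * (z : ℝ) ^ 2)

theorem exists_latticeIneq_exp {a b Y : ℝ} (ha : 0 < a) (hab : a < b) (hY : 1 < Y) :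
    ∃ ε > 0, ∀ l > 0, LatticeIneq a b ε Y fun u => Real.exp (-(l * u)) := by
  have hb : 0 < b := ha.trans hab
  have hπ := Real.pi_pos
  obtain ⟨ε, hε, h⟩ := exists_pos_mul_exp_sub_le (A := Real.pi ^ 2 / b ^ 2)
    (B := Real.pi ^ 2 / a ^ 2) (by positivity) (by gcongr) hY
  refine ⟨ε, hε, fun l hl => ⟨summable_exp_neg_mul_sq hl ha, summable_exp_neg_mul_sq hl hb, ?_⟩⟩
  rw [mul_tsum_exp_neg_mul_sq hl ha, mul_tsum_exp_neg_mul_sq hl hb, ← le_sub_iff_add_le,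
    ← mul_sub]
  refine (h l hl).trans ?_
  have hs : ∀ c > 0, Summable fun z : ℤ => Real.exp (-(Real.pi ^ 2 / c ^ 2 * (z : ℝ) ^ 2 / l)) := by
    intro c hc
    refine (summable_exp_neg_mul_sq (l := 1 / l) (c := Real.pi / c) (by positivity)
      (by positivity)).congr fun z => ?_
    congr 2; field_simp
  rw [← (hs b hb).tsum_sub (hs a ha)]
  gcongr
  -- The dual term `z = 1` alone supplies the margin.
  have := ((hs b hb).sub (hs a ha)).le_tsum 1 fun z _ => sub_nonneg.2 (by
    rw [Real.exp_le_exp, neg_le_neg_iff]; gcongr)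
  simpa using this

/-! ### Closure under nonnegative combinations and dominated limits -/

theorem LatticeIneq.add {a b ε Y : ℝ} {F G : ℝ → ℝ} (hF : LatticeIneq a b ε Y F)
    (hG : LatticeIneq a b ε Y G) : LatticeIneq a b ε Y fun u => F u + G u := by
  refine ⟨hF.1.add hG.1, hF.2.add hG.2, ?_⟩
  rw [hF.1.tsum_add hG.1, hF.2.tsum_add hG.2]
  linarith [hF.3, hG.3]

theorem LatticeIneq.const_mul {a b ε Y : ℝ} {F : ℝ → ℝ} (hF : LatticeIneq a b ε Y F)
    {c : ℝ} (hc : 0 ≤ c) : LatticeIneq a b ε Y fun u => c * F u := by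
  refine ⟨hF.1.mul_left c, hF.2.mul_left c, ?_⟩
  rw [tsum_mul_left, tsum_mul_left]
  linarith [mul_le_mul_of_nonneg_left hF.3 hc]

theorem LatticeIneq.of_tendsto {a b ε Y : ℝ} {F : ℕ → ℝ → ℝ} {G B : ℝ → ℝ} (hY : 0 ≤ Y)
    (hF : ∀ᶠ n in atTop, LatticeIneq a b ε Y (F n))
    (hlim : ∀ u, 0 ≤ u → Tendsto (fun n => F n u) atTop (𝓝 (G u)))
    (hbound : ∀ᶠ n in atTop, ∀ u, 0 ≤ u → ‖F n u‖ ≤ B u)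
    (hBa : Summable fun z : ℤ => B (a ^ 2 * (z : ℝ) ^ 2))
    (hBb : Summable fun z : ℤ => B (b ^ 2 * (z : ℝ) ^ 2)) :
    LatticeIneq a b ε Y G := by
  have hle : ∀ u, 0 ≤ u → ‖G u‖ ≤ B u := fun u hu =>
    le_of_tendsto (hlim u hu).norm (hbound.mono fun n h => h u hu)
  have hta := tendsto_tsum_of_dominated_convergence hBa
    (fun z : ℤ => hlim (a ^ 2 * (z : ℝ) ^ 2) (by positivity))
    (hbound.mono fun n h z => h _ (by positivity))
  have htb := tendsto_tsum_of_dominated_convergence hBb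
    (fun z : ℤ => hlim (b ^ 2 * (z : ℝ) ^ 2) (by positivity))
    (hbound.mono fun n h z => h _ (by positivity))
  refine ⟨hBa.of_norm_bounded fun z => hle _ (by positivity),
    hBb.of_norm_bounded fun z => hle _ (by positivity), ?_⟩
  exact le_of_tendsto_of_tendsto
    ((((hlim 1 zero_le_one).sub ((hlim Y hY).const_mul 2)).const_mul ε).add (hta.const_mul a))
    (htb.const_mul b) (hF.mono fun n h => h.le)

open scoped NNReal Polynomial

/-! ### From exponentials to `exp(-u^α)` -/

theorem neg_one_pow_mul_descPochhammer_nonneg {α : ℝ} (h0 : 0 ≤ α) (h1 : α ≤ 1) (k : ℕ) :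
    0 ≤ (-1) ^ k * (descPochhammer ℤ (k + 1)).smeval α := by
  induction k with
  | zero => simpa using h0
  | succ k ih =>
    rw [descPochhammer_succ_right, Polynomial.smeval_mul]
    have : ((Polynomial.X - ((k + 1 : ℕ) : ℤ[X])).smeval α) = α - (k + 1) := by
      simp [Polynomial.smeval_sub, Polynomial.smeval_natCast]
    rw [this, pow_succ]
    have hk : 0 ≤ (k : ℝ) + 1 - α := by
      have : (0 : ℝ) ≤ k := Nat.cast_nonneg k
      linarith
    nlinarith [mul_nonneg ih hk]

theorem exists_hasSum_one_sub_one_sub_rpow {α : ℝ} (h0 : 0 ≤ α) (h1 : α ≤ 1) :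
    ∃ w : ℕ → ℝ≥0, ∀ x : ℝ, 0 ≤ x → x < 1 →
      HasSum (fun k => (w k : ℝ) * x ^ (k + 1)) (1 - (1 - x) ^ α) := by
  have hw : ∀ k : ℕ, 0 ≤ (-1) ^ k * Ring.choose α (k + 1) := fun k => by
    rw [Ring.choose_eq_smul, smul_eq_mul, mul_left_comm]
    exact mul_nonneg (by positivity) (neg_one_pow_mul_descPochhammer_nonneg h0 h1 k)
  refine ⟨fun k => ⟨_, hw k⟩, fun x hx hx1 => ?_⟩
  have h := (Real.one_add_rpow_hasFPowerSeriesOnBall_zero (a := α)).hasSum (y := -x) (by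
    rw [← ENNReal.ofReal_one, Metric.eball_ofReal]
    simpa [abs_of_nonneg hx] using hx1)
  simp only [binomialSeries_apply, List.ofFn_const, List.prod_replicate, smul_eq_mul,
    zero_add] at h
  rw [← hasSum_nat_add_iff' 1] at h
  have h' := h.neg
  simp only [Finset.range_one, Finset.sum_singleton, Ring.choose_zero_right, pow_zero, mul_one,
    neg_sub, ← sub_eq_add_neg] at h'
  refine h'.congr_fun fun k => ?_
  change (-1) ^ k * Ring.choose α (k + 1) * x ^ (k + 1) = _
  rw [neg_pow x (k + 1)]
  ring

/-- Each monomial yields a multiple of `exp(-(δ + kh)u)`. The factor `exp(-δu)` keeps the constant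
term summable. -/
theorem LatticeIneq.exp_mul_eval₂ {a b ε Y : ℝ}
    (hexp : ∀ l > 0, LatticeIneq a b ε Y fun u => Real.exp (-(l * u)))
    {δ h : ℝ} (hδ : 0 < δ) (hh : 0 ≤ h) (P : ℝ≥0[X]) :
    LatticeIneq a b ε Y fun u =>
      Real.exp (-(δ * u)) * P.eval₂ NNReal.toRealHom (Real.exp (-(h * (u + δ)))) := by
  induction P using Polynomial.induction_on' with
  | add P Q hP hQ => simpa only [Polynomial.eval₂_add, mul_add] using hP.add hQ
  | monomial k c =>
    have hk := (hexp (δ + k * h) (by positivity)).const_mul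
      (c := c * Real.exp (-(k * h * δ))) (by positivity)
    convert hk using 2 with u
    rw [Polynomial.eval₂_monomial, ← Real.exp_nat_mul, NNReal.coe_toRealHom, mul_left_comm,
      mul_assoc, ← Real.exp_add, ← Real.exp_add]
    congr 2
    ring

/-- For `x = exp(-h(u+δ))`, the binomial series of `1 - (1-x)^α` has nonnegative coefficients, so
`exp(c(1 - (1-x)^α))` is a limit of polynomials in `x` of the same kind. The shift by `δ` keeps `x <
1` even at `u = 0`. -/
theorem LatticeIneq.exp_mul_exp_one_sub_rpow {a b ε Y : ℝ} (ha : 0 < a) (hb : 0 < b) (hY : 0 ≤ Y)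
    (hexp : ∀ l > 0, LatticeIneq a b ε Y fun u => Real.exp (-(l * u)))
    {α δ h : ℝ} (h0 : 0 ≤ α) (h1 : α ≤ 1) (hδ : 0 < δ) (hh : 0 < h) (c : ℝ≥0) :
    LatticeIneq a b ε Y fun u =>
      Real.exp (-(δ * u)) * Real.exp (-(c * (1 - Real.exp (-(h * (u + δ)))) ^ α)) := by
  obtain ⟨w, hw⟩ := exists_hasSum_one_sub_one_sub_rpow h0 h1
  let Q : ℕ → ℝ≥0[X] := fun m =>
    (1 + Polynomial.C (c / m) *
      ∑ k ∈ Finset.range m, Polynomial.C (w k) * Polynomial.X ^ (k + 1)) ^ m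
  have hQ : ∀ m x, (Q m).eval₂ NNReal.toRealHom x =
      (1 + (c : ℝ) / m * ∑ k ∈ Finset.range m, (w k : ℝ) * x ^ (k + 1)) ^ m := fun m x => by
    simp [Q, Polynomial.eval₂_pow, Polynomial.eval₂_add, Polynomial.eval₂_mul,
      Polynomial.eval₂_finsetSum]
  have hx : ∀ u, 0 ≤ u → Real.exp (-(h * (u + δ))) < 1 := fun u hu => by
    rw [Real.exp_lt_one_iff]
    have : 0 < h * (u + δ) := by positivity
    linarith
  refine LatticeIneq.of_tendsto (B := fun u => Real.exp (-(δ * u))) hY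
    (F := fun m u => Real.exp (-c) * (Real.exp (-(δ * u)) *
      (Q m).eval₂ NNReal.toRealHom (Real.exp (-(h * (u + δ))))))
    (Eventually.of_forall fun m =>
      (LatticeIneq.exp_mul_eval₂ hexp hδ hh.le (Q m)).const_mul (Real.exp_pos _).le)
    (fun u hu => ?_) ?_ (summable_exp_neg_mul_sq hδ ha) (summable_exp_neg_mul_sq hδ hb)
  · have hs := (hw _ (Real.exp_pos _).le (hx u hu)).tendsto_sum_nat.const_mul (c : ℝ)
    have hlim : Tendsto (fun m => (Q m).eval₂ NNReal.toRealHom (Real.exp (-(h * (u + δ)))))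
        atTop (𝓝 (Real.exp (c * (1 - (1 - Real.exp (-(h * (u + δ)))) ^ α)))) := by
      simp only [hQ]
      refine Real.tendsto_one_add_pow_exp_of_tendsto (hs.congr' ?_)
      filter_upwards [eventually_gt_atTop 0] with m hm
      have : (m : ℝ) ≠ 0 := by positivity
      field_simp
    convert (hlim.const_mul (Real.exp (-(δ * u)))).const_mul (Real.exp (-c)) using 2
    simp only [← Real.exp_add]
    congr 1
    ring
  · filter_upwards [eventually_gt_atTop 0] with m hm u hu
    have hs := hw _ (Real.exp_pos _).le (hx u hu)
    have hm' : (m : ℝ) ≠ 0 := by positivity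
    have hle := hs.summable.sum_le_tsum (Finset.range m) fun k _ => by positivity
    rw [hs.tsum_eq] at hle
    have hle1 : ∑ k ∈ Finset.range m, (w k : ℝ) * Real.exp (-(h * (u + δ))) ^ (k + 1) ≤ 1 :=
      hle.trans (sub_le_self _ (Real.rpow_nonneg (sub_nonneg.2 (hx u hu).le) _))
    have hev : (Q m).eval₂ NNReal.toRealHom (Real.exp (-(h * (u + δ)))) ≤ Real.exp c := by
      rw [hQ]
      calc _ ≤ (1 + (c : ℝ) / m * 1) ^ m := by gcongr
        _ ≤ Real.exp ((c : ℝ) / m) ^ m := by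
          gcongr; linarith [Real.add_one_le_exp ((c : ℝ) / m)]
        _ = Real.exp c := by rw [← Real.exp_nat_mul]; congr 1; field_simp
    have hev0 : 0 ≤ (Q m).eval₂ NNReal.toRealHom (Real.exp (-(h * (u + δ)))) := by
      rw [hQ]; positivity
    rw [Real.norm_of_nonneg (by positivity)]
    calc _ ≤ Real.exp (-c) * (Real.exp (-(δ * u)) * Real.exp c) := by gcongr
      _ = _ := by rw [mul_left_comm, ← Real.exp_add]; simp

theorem tendsto_nat_mul_one_sub_exp_neg_div {v : ℝ} (hv : 0 ≤ v) :
    Tendsto (fun n : ℕ => (n : ℝ) * (1 - Real.exp (-(1 / n * v)))) atTop (𝓝 v) := by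
  have hl : Tendsto (fun n : ℕ => v / (1 + v / n)) atTop (𝓝 v) := by
    have h := (tendsto_const_nhds (x := v)).div
      ((tendsto_const_div_atTop_nhds_zero_nat v).const_add 1) (by simp)
    rwa [add_zero, div_one] at h
  refine tendsto_of_tendsto_of_tendsto_of_le_of_le' hl tendsto_const_nhds ?_ ?_
  all_goals
    filter_upwards [eventually_gt_atTop 0] with n hn
    have hn' : (0 : ℝ) < n := by positivity
  · have h : Real.exp (-(1 / n * v)) ≤ 1 / (1 + v / n) := by
      rw [Real.exp_neg, one_div (1 + v / n)]
      gcongr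
      linarith [Real.add_one_le_exp (1 / n * v), show 1 / n * v = v / n by ring]
    calc v / (1 + v / n) = n * (1 - 1 / (1 + v / n)) := by field_simp; ring
      _ ≤ _ := by gcongr
  · have h := Real.add_one_le_exp (-(1 / n * v))
    calc _ ≤ n * (1 / n * v) := by gcongr; linarith
      _ = v := by field_simp

theorem LatticeIneq.exp_neg_rpow {a b ε Y : ℝ} (ha : 0 < a) (hb : 0 < b) (hY : 0 ≤ Y)
    (hexp : ∀ l > 0, LatticeIneq a b ε Y fun u => Real.exp (-(l * u)))
    {α : ℝ} (h0 : 0 < α) (h1 : α ≤ 1) :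
    LatticeIneq a b ε Y fun u => Real.exp (-u ^ α) := by
  -- With `h = 1/n` and `c = n^α`, `c (1 - exp(-h(u+δ)))^α` tends to `(u+δ)^α`; then `δ → 0`.
  have hreg : ∀ δ > 0, LatticeIneq a b ε Y fun u =>
      Real.exp (-(δ * u)) * Real.exp (-(u + δ) ^ α) := fun δ hδ => by
    refine LatticeIneq.of_tendsto (B := fun u => Real.exp (-(δ * u))) hY
      (F := fun n u => Real.exp (-(δ * u)) *
        Real.exp (-(((n : ℝ≥0) ^ α : ℝ≥0) * (1 - Real.exp (-(1 / n * (u + δ)))) ^ α)))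
      ?_ (fun u hu => ?_) ?_ (summable_exp_neg_mul_sq hδ ha) (summable_exp_neg_mul_sq hδ hb)
    · filter_upwards [eventually_gt_atTop 0] with n hn
      exact LatticeIneq.exp_mul_exp_one_sub_rpow ha hb hY hexp h0.le h1 hδ (by positivity) _
    · refine Tendsto.const_mul _ ((Real.continuous_exp.tendsto _).comp (Tendsto.neg ?_))
      have ht := (tendsto_nat_mul_one_sub_exp_neg_div (v := u + δ) (by positivity)).rpow_const
        (p := α) (Or.inr h0.le)
      refine ht.congr fun n => ?_
      rw [Real.mul_rpow (by positivity)]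
      · simp
      · rw [sub_nonneg, Real.exp_le_one_iff, neg_nonpos]; positivity
    · refine Eventually.of_forall fun n u hu => ?_
      rw [Real.norm_of_nonneg (by positivity)]
      refine mul_le_of_le_one_right (Real.exp_pos _).le ?_
      rw [Real.exp_le_one_iff, neg_nonpos]
      refine mul_nonneg (by positivity) (Real.rpow_nonneg ?_ _)
      rw [sub_nonneg, Real.exp_le_one_iff, neg_nonpos]; positivity
  refine LatticeIneq.of_tendsto (B := fun u => Real.exp (-u ^ α)) hY
    (Eventually.of_forall fun n : ℕ => hreg (1 / ((n : ℝ) + 1)) (by positivity))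
    (fun u hu => ?_) (Eventually.of_forall fun n u hu => ?_)
    (summable_exp_neg_rpow_sq ha h0) (summable_exp_neg_rpow_sq hb h0)
  · have ht := tendsto_one_div_add_atTop_nhds_zero_nat (𝕜 := ℝ)
    have h2 := ((Real.continuous_exp.tendsto _).comp (ht.mul_const u).neg).mul
      ((Real.continuous_exp.tendsto _).comp
        ((ht.const_add u).rpow_const (p := α) (Or.inr h0.le)).neg)
    simpa using h2
  · rw [Real.norm_of_nonneg (by positivity)]
    refine (mul_le_of_le_one_left (Real.exp_pos _).le ?_).trans ?_
    · rw [Real.exp_le_one_iff, neg_nonpos]; positivity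
    · rw [Real.exp_le_exp, neg_le_neg_iff]
      gcongr
      exact le_add_of_nonneg_right (by positivity)

theorem mul_tsum_exp_neg_rpow_lt {a b α : ℝ} (ha : 0 < a) (hab : a < b) (h0 : 0 < α)
    (h1 : α ≤ 1) :
    a * ∑' z : ℤ, Real.exp (-(a ^ 2 * (z : ℝ) ^ 2) ^ α) <
      b * ∑' z : ℤ, Real.exp (-(b ^ 2 * (z : ℝ) ^ 2) ^ α) := by
  -- This `Y` makes the margin `ε (e⁻¹ - 2e⁻²)`, positive because `e > 2`.
  have hY : (1 : ℝ) < 2 ^ (1 / α) := Real.one_lt_rpow one_lt_two (by positivity)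
  obtain ⟨ε, hε, h⟩ := exists_latticeIneq_exp ha hab hY
  have hle := (LatticeIneq.exp_neg_rpow ha (ha.trans hab) (zero_le_one.trans hY.le) h h0 h1).le
  have hpos : 0 < Real.exp (-(1 : ℝ) ^ α) - 2 * Real.exp (-((2 : ℝ) ^ (1 / α)) ^ α) := by
    rw [Real.one_rpow, ← Real.rpow_mul two_pos.le, one_div_mul_cancel h0.ne', Real.rpow_one,
      show (-2 : ℝ) = -1 + -1 by norm_num, Real.exp_add]
    have h2 : 2 * Real.exp (-1) < 1 := by
      rw [Real.exp_neg, ← div_eq_mul_inv, div_lt_one (Real.exp_pos _)]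
      linarith [Real.exp_one_gt_d9]
    nlinarith [Real.exp_pos (-1)]
  linarith [mul_pos hε hpos]

/-! ### The functions `f_t` -/

theorem cp_pos {p : ℝ} (hp : 0 < p) : 0 < cp p :=
  mul_pos two_pos (Real.Gamma_pos_of_pos (by positivity))

theorem scaled_fp_eq (p : ℝ) {t : ℝ} (ht : 0 < t) (x : ℝ) :
    scaled (fp p) t x = Real.exp (-(cp p / t * |x|) ^ p) := by
  rw [scaled, fp, abs_div, abs_of_pos ht, div_mul_eq_mul_div, mul_div_assoc]

theorem scaled_fp_eq_rpow_sq {p t : ℝ} (hp : 0 < p) (ht : 0 < t) (x : ℝ) :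
    scaled (fp p) t x = Real.exp (-((cp p / t) ^ 2 * x ^ 2) ^ (p / 2)) := by
  have := cp_pos hp
  rw [scaled_fp_eq p ht, ← sq_abs x, ← mul_pow, ← Real.rpow_natCast _ 2,
    ← Real.rpow_mul (by positivity)]
  congr 3
  push_cast
  ring

theorem scaled_fp_pos (p t x : ℝ) : 0 < scaled (fp p) t x := Real.exp_pos _

theorem measurable_scaled_fp (p t : ℝ) : Measurable (scaled (fp p) t) := by
  unfold scaled fp
  fun_prop

theorem integral_scaled_fp {p t : ℝ} (hp : 0 < p) (ht : 0 < t) :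
    ∫ x, scaled (fp p) t x = t := by
  have hc := cp_pos hp
  simp only [scaled_fp_eq p ht]
  rw [integral_comp_abs (f := fun x => Real.exp (-(cp p / t * x) ^ p)),
    integral_comp_mul_left_Ioi (fun x => Real.exp (-x ^ p)) 0 (by positivity), mul_zero,
    integral_exp_neg_rpow hp, smul_eq_mul, inv_div, add_comm (1 / p), mul_left_comm,
    div_mul_eq_mul_div]
  exact mul_div_cancel_right₀ t hc.ne'

theorem integrable_scaled_fp {p t : ℝ} (hp : 0 < p) (ht : 0 < t) :
    Integrable (scaled (fp p) t) :=
  -- A non-integrable function would have integral `0` by convention.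
  .of_integral_ne_zero (by rw [integral_scaled_fp hp ht]; exact ht.ne')

theorem summable_scaled_fp {p t : ℝ} (hp : 0 < p) (ht : 0 < t) :
    Summable fun z : ℤ => scaled (fp p) t z := by
  have := cp_pos hp
  simp only [scaled_fp_eq_rpow_sq hp ht]
  exact summable_exp_neg_rpow_sq (by positivity) (by positivity)

theorem tsum_scaled_fp_pos {p t : ℝ} (hp : 0 < p) (ht : 0 < t) :
    0 < ∑' z : ℤ, scaled (fp p) t z :=
  (summable_scaled_fp hp ht).tsum_pos (fun z => (scaled_fp_pos p t z).le) 0 (scaled_fp_pos p t _)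

theorem lpNorm_pair (p : ℝ) {r s : ℝ} (hr : 0 < r) (hs : 0 < s) :
    lpNorm p ![r, s] = (r ^ p + s ^ p) ^ (1 / p) := by
  simp [lpNorm, abs_of_pos hr, abs_of_pos hs]

theorem lt_lpNorm_pair {p r s : ℝ} (hp : 0 < p) (hr : 0 < r) (hs : 0 < s) :
    s < lpNorm p ![r, s] := by
  have h : (s ^ p) ^ (1 / p) < (r ^ p + s ^ p) ^ (1 / p) := by
    gcongr
    exact lt_add_of_pos_left _ (by positivity)
  rwa [← Real.rpow_mul hs.le, mul_one_div_cancel hp.ne', Real.rpow_one, ← lpNorm_pair p hr hs] at h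

/-- The exponents add: `r^(-p) + s^(-p) = (‖(r,s)‖_p / (rs))^p`. -/
theorem scaled_fp_mul_scaled_fp {p r s : ℝ} (hp : 0 < p) (hr : 0 < r) (hs : 0 < s) (x : ℝ) :
    scaled (fp p) r x * scaled (fp p) s x =
      scaled (fp p) (r * s / lpNorm p ![r, s]) x := by
  have hc := cp_pos hp
  have hN : 0 < lpNorm p ![r, s] := hs.trans (lt_lpNorm_pair hp hr hs)
  have hNp : lpNorm p ![r, s] ^ p = r ^ p + s ^ p := by
    rw [lpNorm_pair p hr hs, ← Real.rpow_mul (by positivity), one_div_mul_cancel hp.ne',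
      Real.rpow_one]
  rw [scaled_fp_eq p hr, scaled_fp_eq p hs, scaled_fp_eq p (by positivity), ← Real.exp_add]
  congr 1
  have hr' := Real.rpow_pos_of_pos hr p
  have hs' := Real.rpow_pos_of_pos hs p
  rw [Real.mul_rpow (by positivity) (by positivity), Real.mul_rpow (by positivity) (by positivity),
    Real.mul_rpow (by positivity) (by positivity), Real.div_rpow hc.le hr.le,
    Real.div_rpow hc.le hs.le, Real.div_rpow hc.le (by positivity),
    Real.div_rpow (by positivity) hN.le, Real.mul_rpow hr.le hs.le, hNp]
  field_simp
  ring

/-! ### Measures with a density, and the conclusion -/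

theorem isProbabilityMeasure_withDensity_ofReal {Ω : Type*} [MeasurableSpace Ω] {μ : Measure Ω}
    {g : Ω → ℝ} (hg : Integrable g μ) (h0 : ∀ x, 0 ≤ g x) (h1 : ∫ x, g x ∂μ = 1) :
    IsProbabilityMeasure (μ.withDensity fun x => ENNReal.ofReal (g x)) := by
  constructor
  rw [withDensity_apply _ MeasurableSet.univ, Measure.restrict_univ,
    ← ofReal_integral_eq_lintegral_ofReal hg (Eventually.of_forall h0), h1, ENNReal.ofReal_one]

theorem integrable_withDensity_ofReal_iff {Ω : Type*} [MeasurableSpace Ω] {μ : Measure Ω}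
    {g h : Ω → ℝ} (hg : Measurable g) (h0 : ∀ x, 0 ≤ g x) :
    Integrable h (μ.withDensity fun x => ENNReal.ofReal (g x)) ↔
      Integrable (fun x => g x * h x) μ := by
  rw [integrable_withDensity_iff_integrable_smul' hg.ennreal_ofReal
    (Eventually.of_forall fun _ => ENNReal.ofReal_lt_top)]
  simp only [ENNReal.toReal_ofReal (h0 _), smul_eq_mul]

theorem integral_withDensity_ofReal {Ω : Type*} [MeasurableSpace Ω] {μ : Measure Ω}
    {g : Ω → ℝ} (h : Ω → ℝ) (hg : Measurable g) (h0 : ∀ x, 0 ≤ g x) :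
    ∫ x, h x ∂(μ.withDensity fun x => ENNReal.ofReal (g x)) = ∫ x, g x * h x ∂μ := by
  rw [integral_withDensity_eq_integral_toReal_smul hg.ennreal_ofReal
    (Eventually.of_forall fun _ => ENNReal.ofReal_lt_top)]
  simp only [ENNReal.toReal_ofReal (h0 _), smul_eq_mul]

theorem integral_count_int {f : ℤ → ℝ} (hf : Summable f) :
    ∫ z, f z ∂Measure.count = ∑' z, f z := by
  rw [integral_countable (integrable_count_iff.2 hf.norm)]
  simp [Measure.real]

end SoftDecoding

open SoftDecoding

theorem lemma4p4 (p r s : ℝ) (hp0 : 0 < p) (hp2 : p ≤ 2) (hr : 0 < r) (hs : 0 < s) :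
    (IsProbabilityMeasure (SoftDecoding.contDist p r) ∧
      Integrable (fun e : ℝ => SoftDecoding.scaled (SoftDecoding.fp p) s e)
        (SoftDecoding.contDist p r) ∧
      SoftDecoding.muCont p r s = s / SoftDecoding.lpNorm p ![r, s]) ∧
    (IsProbabilityMeasure (SoftDecoding.discDist p r) ∧
      Integrable (fun e : ℤ => SoftDecoding.scaled (SoftDecoding.fp p) s (e : ℝ))
        (SoftDecoding.discDist p r) ∧
      SoftDecoding.muDisc p r s > s / SoftDecoding.lpNorm p ![r, s]) := by
  have hc := cp_pos hp0
  have hlt := lt_lpNorm_pair hp0 hr hs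
  have hN : 0 < lpNorm p ![r, s] := hs.trans hlt
  have hmul := scaled_fp_mul_scaled_fp hp0 hr hs
  obtain ⟨t, ht⟩ : ∃ t, t = r * s / lpNorm p ![r, s] := ⟨_, rfl⟩
  rw [← ht] at hmul
  have ht0 : 0 < t := by rw [ht]; positivity
  have htr : t < r := by
    rw [ht, div_lt_iff₀ hN]
    exact mul_lt_mul_of_pos_left hlt hr
  have hts : s / lpNorm p ![r, s] = t / r := by rw [ht]; field_simp
  have hcg : ∀ x, 0 ≤ scaled (fp p) r x / r := fun x =>
    div_nonneg (scaled_fp_pos p r x).le hr.le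
  have hcm : Measurable fun x => scaled (fp p) r x / r := (measurable_scaled_fp p r).div_const r
  have hcprod : ∀ x, scaled (fp p) r x / r * scaled (fp p) s x = scaled (fp p) t x / r := fun x => by
    rw [div_mul_eq_mul_div, hmul]
  have hS := tsum_scaled_fp_pos hp0 hr
  have hdg : ∀ z : ℤ, 0 ≤ scaled (fp p) r z / ∑' z : ℤ, scaled (fp p) r z := fun z =>
    div_nonneg (scaled_fp_pos p r z).le hS.le
  have hdm : Measurable fun z : ℤ => scaled (fp p) r z / ∑' z : ℤ, scaled (fp p) r z :=
    measurable_of_countable _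
  have hdprod : ∀ z : ℤ, (scaled (fp p) r z / ∑' z : ℤ, scaled (fp p) r z) * scaled (fp p) s z =
      scaled (fp p) t z / ∑' z : ℤ, scaled (fp p) r z := fun z => by
    rw [div_mul_eq_mul_div, hmul]
  have hsr := (summable_scaled_fp hp0 hr).div_const (∑' z : ℤ, scaled (fp p) r z)
  have hst := (summable_scaled_fp hp0 ht0).div_const (∑' z : ℤ, scaled (fp p) r z)
  refine ⟨⟨?_, ?_, ?_⟩, ?_, ?_, ?_⟩
  · refine isProbabilityMeasure_withDensity_ofReal ((integrable_scaled_fp hp0 hr).div_const r) hcg ?_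
    rw [integral_div, integral_scaled_fp hp0 hr, div_self hr.ne']
  · rw [contDist, integrable_withDensity_ofReal_iff hcm hcg]
    simp only [hcprod]
    exact (integrable_scaled_fp hp0 ht0).div_const r
  · rw [muCont, contDist, integral_withDensity_ofReal _ hcm hcg]
    simp only [hcprod]
    rw [integral_div, integral_scaled_fp hp0 ht0, hts]
  · refine isProbabilityMeasure_withDensity_ofReal (integrable_count_iff.2 hsr.norm) hdg ?_
    rw [integral_count_int hsr, tsum_div_const, div_self hS.ne']
  · rw [discDist, integrable_withDensity_ofReal_iff hdm hdg]
    simp only [hdprod]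
    exact integrable_count_iff.2 hst.norm
  · rw [muDisc, discDist, integral_withDensity_ofReal _ hdm hdg]
    simp only [hdprod]
    rw [integral_count_int hst, tsum_div_const, hts, gt_iff_lt, div_lt_div_iff₀ hr hS]
    -- `t < r` orders the two lattice scales, and `p ≤ 2` gives `α ≤ 1`.
    have hmain := mul_tsum_exp_neg_rpow_lt (a := cp p / r) (b := cp p / t) (α := p / 2)
      (by positivity) (by gcongr) (by positivity) (by linarith)
    simp only [← scaled_fp_eq_rpow_sq hp0 hr, ← scaled_fp_eq_rpow_sq hp0 ht0] at hmain
    rw [div_mul_eq_mul_div, div_mul_eq_mul_div, mul_div_assoc, mul_div_assoc,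
      mul_lt_mul_iff_right₀ hc, div_lt_div_iff₀ hr ht0] at hmain
    linarith
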